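/- Let $M$ be a matroid on a finite ground set, of rank at least $3$, and let $A$ and $B$ be disjoint bases of $M$. Then three elements of $A$ can be serially and symmetrically exchanged with some three elements of $B$. That is, there exist pairwise distinct $a_1,a_2,a_3\in A$ and pairwise distinct $b_1,b_2,b_3\in B$ such that, setting $A_0=A$, $B_0=B$ and $A_i=(A_{i-1}\setminus\{a_i\})\cup\{b_i\}$, $B_i=(B_{i-1}\setminus\{b_i\})\cup\{a_i\}$ for $i=1,2,3$, all of the sets $A_1,B_1,A_2,B_2,A_3,B_3$ are bases of $M$. -/

import Mathlib

namespace Matroid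

/-- `a` and `b` are exchangeable relative to the bases `A` and `B` of `M`:
`a ∈ A`, `b ∈ B`, and both `A - a + b` and `B - b + a` are bases. -/
def Exchangeable {α : Type*} (M : Matroid α) (A B : Set α) (a b : α) : Prop :=
  a ∈ A ∧ b ∈ B ∧ M.IsBase (insert b (A \ {a})) ∧ M.IsBase (insert a (B \ {b}))

/-- The pairs `(a, b)` of the list can be exchanged one after the other, in this order, starting
from `A` and `B`: each pair is exchangeable relative to the two sets that the preceding exchanges
have produced. -/
def IsSerialSymmetricExchange {α : Type*} (M : Matroid α) :
    Set α → Set α → List (α × α) → Prop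
  | _, _, [] => True
  | A, B, (a, b) :: l =>
      M.Exchangeable A B a b ∧
        M.IsSerialSymmetricExchange (insert b (A \ {a})) (insert a (B \ {b})) l

end Matroid

/-! Write `s X Y` for "`A \ X ∪ Y` is a base" and `t X Y` for "`B \ Y ∪ X` is a base". Over a field
these say that minors of a matrix, respectively of its inverse, do not vanish. Both relations obey
the same local rules (`SwapRules`), for `t` by duality.

Suppose no serial triple exists. If `{b, c}` is traded for a pair of `A` in two serial steps,
symmetric exchange of any further `u ∈ A` cannot produce a triple, so it puts `u` into a pair traded
for `{b, c}`. Hence `u` swaps with `b` or `c` under `s`, and likewise under `t` (`covers`). Two such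
pairs `{b, c}`, `{b, d}` exist (`exists_covers`).

Subset exchange, a consequence of matroid partition, trades `{b, c, d}` for a triple of `A`. The
covering conditions make every such triple rigid (`shape`); in particular none of its members is
exchangeable with `b`. Yet some `a` is. Trading `{c, d}` after `(a, b)` gives either a triple
through `a`, which is absurd, or a pair `{a, x}` traded for `{c, d}`. If that pair is serial, `{c,
d}` covers too, against `shape`. If not, `a` and `x` are in opposite position (`opposite`), and some
member of a rigid triple completes `{a, x}` to a serial triple (`false_of_opposite`). -/

namespace Matroid

open Set

variable {α : Type*} {M : Matroid α} {A B I K P Q X Y : Set α} {a b c d e x y z : α}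

/-! ### Matroid partition and symmetric exchange -/

/-- A rank-function form of the matroid partition theorem for two contractions of a matroid. -/
theorem exists_partition_of_card_le [DecidableEq α] (r : Finset α → ℕ)
    (mono : ∀ X Y, X ⊆ Y → r X ≤ r Y)
    (submod : ∀ X Y, r (X ∩ Y) + r (X ∪ Y) ≤ r X + r Y)
    (unit : ∀ e X, r (insert e X) ≤ r X + 1) (Z P Q : Finset α)
    (h : ∀ W ⊆ Z, W.card + r P + r Q ≤ r (W ∪ P) + r (W ∪ Q)) :
    ∃ I J, I ∪ J = Z ∧ Disjoint I J ∧ r P + I.card ≤ r (I ∪ P) ∧ r Q + J.card ≤ r (J ∪ Q) := by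
  induction hn : Z.card using Nat.strong_induction_on generalizing Z P Q with
  | _ n ih =>
  subst hn
  -- A proper nonempty tight `W` is partitioned first, then the rest over `W ∪ P` and `W ∪ Q`;
  -- submodularity glues the two partitions.
  by_cases htight : ∃ W ⊆ Z, W ≠ Z ∧ W.Nonempty ∧ r (W ∪ P) + r (W ∪ Q) ≤ W.card + r P + r Q
  · obtain ⟨W, hWZ, hne, hW, hle⟩ := htight
    obtain ⟨I, J, rfl, hIJ, hI, hJ⟩ := ih W.card
      (Finset.card_lt_card (hWZ.ssubset_of_ne hne)) W P Q (fun V hV ↦ h V (hV.trans hWZ)) rfl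
    have hlt : (Z \ (I ∪ J)).card < Z.card :=
      Finset.card_lt_card (Finset.sdiff_ssubset hWZ hW)
    obtain ⟨I', J', hZ, hIJ', hI', hJ'⟩ := ih _ hlt (Z \ (I ∪ J)) (I ∪ J ∪ P) (I ∪ J ∪ Q)
      (fun V hV ↦ by
        have h1 := h (V ∪ (I ∪ J)) (Finset.union_subset (hV.trans Finset.sdiff_subset) hWZ)
        rw [Finset.card_union_of_disjoint
          (Finset.disjoint_of_subset_left hV Finset.sdiff_disjoint)] at h1
        simp only [Finset.union_assoc] at *
        omega) rfl
    have hd : Disjoint (I ∪ J) (I' ∪ J') := hZ ▸ Finset.disjoint_sdiff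
    simp only [Finset.disjoint_union_left, Finset.disjoint_union_right] at hd
    refine ⟨I ∪ I', J ∪ J', ?_, ?_, ?_, ?_⟩
    · rw [Finset.union_union_union_comm, hZ, Finset.union_sdiff_of_subset hWZ]
    · simp only [Finset.disjoint_union_left, Finset.disjoint_union_right]
      exact ⟨⟨hIJ, hd.1.2.symm⟩, hd.2.1, hIJ'⟩
    · rw [Finset.card_union_of_disjoint hd.1.1]
      have h1 := submod (I ∪ I' ∪ P) (I ∪ J ∪ P)
      have h2 := mono (I ∪ P) ((I ∪ I' ∪ P) ∩ (I ∪ J ∪ P)) (by grind)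
      have h3 := mono (I' ∪ (I ∪ J ∪ P)) ((I ∪ I' ∪ P) ∪ (I ∪ J ∪ P)) (by grind)
      omega
    · rw [Finset.card_union_of_disjoint hd.2.2]
      have h1 := submod (J ∪ J' ∪ Q) (I ∪ J ∪ Q)
      have h2 := mono (J ∪ Q) ((J ∪ J' ∪ Q) ∩ (I ∪ J ∪ Q)) (by grind)
      have h3 := mono (J' ∪ (I ∪ J ∪ Q)) ((J ∪ J' ∪ Q) ∪ (I ∪ J ∪ Q)) (by grind)
      omega
  push Not at htight
  obtain rfl | ⟨e, he⟩ := Z.eq_empty_or_nonempty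
  · exact ⟨∅, ∅, by simp⟩
  have hlt : (Z.erase e).card < Z.card := Finset.card_erase_lt_of_mem he
  -- With no tight set, every nonempty `W` avoiding `e` has a unit to spare, which pays for adding
  -- `e` to `P` or `Q`.
  have hstrict : ∀ W ⊆ Z.erase e, W.Nonempty →
      W.card + 1 + r P + r Q ≤ r (W ∪ P) + r (W ∪ Q) := fun W hW hne ↦ by
    have := htight W (hW.trans (Z.erase_subset e)) (by grind) hne
    omega
  have h1 := h {e} (by simpa)
  simp only [Finset.card_singleton] at h1
  obtain h1 | h1 : r P + 1 ≤ r ({e} ∪ P) ∨ r Q + 1 ≤ r ({e} ∪ Q) := by omega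
  · have h2 := unit e P
    rw [Finset.insert_eq] at h2
    obtain ⟨I, J, hZ, hIJ, hI, hJ⟩ := ih _ hlt (Z.erase e) ({e} ∪ P) Q (fun W hW ↦ by
      obtain rfl | hne := W.eq_empty_or_nonempty
      · simp
      have := hstrict W hW hne
      have := mono (W ∪ P) (W ∪ ({e} ∪ P)) (by grind)
      omega) rfl
    refine ⟨insert e I, J, by grind, by grind, ?_, hJ⟩
    have := mono (I ∪ ({e} ∪ P)) (insert e I ∪ P) (by grind)
    rw [Finset.card_insert_of_notMem (by grind)]
    omega
  · have h2 := unit e Q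
    rw [Finset.insert_eq] at h2
    obtain ⟨I, J, hZ, hIJ, hI, hJ⟩ := ih _ hlt (Z.erase e) P ({e} ∪ Q) (fun W hW ↦ by
      obtain rfl | hne := W.eq_empty_or_nonempty
      · simp
      have := hstrict W hW hne
      have := mono (W ∪ Q) (W ∪ ({e} ∪ Q)) (by grind)
      omega) rfl
    refine ⟨I, insert e J, by grind, by grind, hI, ?_⟩
    have := mono (J ∪ ({e} ∪ Q)) (insert e J ∪ Q) (by grind)
    rw [Finset.card_insert_of_notMem (by grind)]
    omega

/-- **Symmetric subset exchange**. -/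
theorem IsBase.exists_subset_exchange [M.RankFinite] (hA : M.IsBase A) (hB : M.IsBase B)
    (hY : Y ⊆ B) :
    ∃ X ⊆ A, X.encard = Y.encard ∧ M.IsBase (A \ X ∪ Y) ∧ M.IsBase (B \ Y ∪ X) := by
  classical
  have hcard := hA.encard_eq_encard_of_isBase hB
  have hrk := hB.encard_eq_eRank
  obtain ⟨B, rfl⟩ := hB.finite.exists_finset_coe
  obtain ⟨A, rfl⟩ := hA.finite.exists_finset_coe
  obtain ⟨Y, rfl⟩ := (B.finite_toSet.subset hY).exists_finset_coe
  have hYB : Y ⊆ B := by exact_mod_cast hY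
  have hcard' : A.card = B.card := by
    simpa only [encard_coe_eq_coe_finsetCard, Nat.cast_inj] using hcard
  set r : Finset α → ℕ := fun X ↦ (M.eRk X).toNat with hr
  have hr' (X : Finset α) : (r X : ℕ∞) = M.eRk X :=
    ENat.natCast_toNat (eRk_lt_top_iff.2 (RankFinite.isRkFinite _)).ne
  have mono (X Y : Finset α) (h : X ⊆ Y) : r X ≤ r Y := by
    have := M.eRk_mono (Finset.coe_subset.2 h)
    simpa only [← hr', Nat.cast_le] using this
  have submod (X Y : Finset α) : r (X ∩ Y) + r (X ∪ Y) ≤ r X + r Y := by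
    have := M.eRk_inter_add_eRk_union_le X Y
    rw [← Finset.coe_inter, ← Finset.coe_union] at this
    simp only [← hr'] at this
    exact_mod_cast this
  have unit (e : α) (X : Finset α) : r (insert e X) ≤ r X + 1 := by
    have := M.eRk_insert_le_add_one e X
    rw [← Finset.coe_insert] at this
    simp only [← hr'] at this
    exact_mod_cast this
  have indep (X : Finset α) (h : M.Indep X) : r X = X.card := by
    have := h.eRk_eq_encard
    rw [← hr', encard_coe_eq_coe_finsetCard] at this
    exact_mod_cast this
  have le_rank (X : Finset α) : r X ≤ B.card := by
    have := M.eRk_le_eRank X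
    rw [← hr', ← hrk, encard_coe_eq_coe_finsetCard] at this
    exact_mod_cast this
  have isBase (X : Finset α) (h : B.card ≤ r X) (h' : X.card ≤ r X) : M.IsBase X := by
    refine Indep.isBase_of_eRk_ge ?_ X.finite_toSet ?_
    · refine IsRkFinite.indep_of_encard_le_eRk (RankFinite.isRkFinite _) ?_
      rw [← hr', encard_coe_eq_coe_finsetCard]
      exact_mod_cast h'
    · rw [← hrk, ← hr', encard_coe_eq_coe_finsetCard]
      exact_mod_cast h
  have hrP : r (B \ Y) = (B \ Y).card := indep _ (hB.indep.subset (by simp))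
  have hrQ : r Y = Y.card := indep _ (hB.indep.subset (by simpa))
  have hBY := Finset.card_sdiff_add_card_eq_card hYB
  -- `W ∪ B \ Y` and `W ∪ Y` both contain `W` and together contain `B`, so submodularity gives the
  -- rank condition.
  obtain ⟨I, J, rfl, hIJ, hI, hJ⟩ := exists_partition_of_card_le r mono submod unit A (B \ Y) Y
    (fun W hW ↦ by
      have h1 := submod (W ∪ B \ Y) (W ∪ Y)
      have h2 := mono W ((W ∪ B \ Y) ∩ (W ∪ Y)) (by grind)
      have h3 := mono B ((W ∪ B \ Y) ∪ (W ∪ Y)) (by grind)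
      have h4 := indep W (hA.indep.subset (by exact_mod_cast hW))
      have h5 := indep B hB.indep
      omega)
  rw [Finset.card_union_of_disjoint hIJ] at hcard'
  -- The two ranks are at most `B.card` each and sum to at least twice that, so both unions are
  -- bases.
  have h1 := le_rank (I ∪ B \ Y)
  have h2 := le_rank (J ∪ Y)
  have h3 := Finset.card_union_le I (B \ Y)
  have h4 := Finset.card_union_le J Y
  refine ⟨I, by simp, ?_, ?_, ?_⟩
  · rw [encard_coe_eq_coe_finsetCard, encard_coe_eq_coe_finsetCard]
    norm_cast
    omega
  · have := isBase (J ∪ Y) (by omega) (by omega)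
    convert this using 1
    rw [Finset.coe_union, Finset.coe_union, union_sdiff_cancel_left]
    exact (disjoint_iff_inter_eq_empty.1 (by exact_mod_cast hIJ)).subset
  · have := isBase (I ∪ B \ Y) (by omega) (by omega)
    convert this using 1
    rw [Finset.coe_union, Finset.coe_sdiff, union_comm]

/-- The symmetric exchange property of bases. -/
theorem IsBase.exists_symmetric_exchange (hP : M.IsBase P) (hQ : M.IsBase Q) (he : e ∈ P)
    (heQ : e ∉ Q) :
    ∃ f ∈ Q, f ∉ P ∧ M.IsBase (insert f (P \ {e})) ∧ M.IsBase (insert e (Q \ {f})) := by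
  have heE := hP.subset_ground he
  have hC := hQ.fundCircuit_isCircuit heE heQ
  have hnot := hP.indep.notMem_closure_sdiff_of_mem he
  -- Otherwise the rest of the fundamental circuit would put `e` into `M.closure (P \ {e})`.
  obtain ⟨f, ⟨hfC, hfe⟩, hf⟩ : ∃ f ∈ M.fundCircuit e Q \ {e}, f ∉ M.closure (P \ {e}) := by
    by_contra! hcon
    exact hnot (M.closure_subset_closure_of_subset_closure hcon
      (hC.mem_closure_sdiff_singleton_of_mem (M.mem_fundCircuit e Q)))
  have hfQ : f ∈ Q := (M.fundCircuit_subset_insert e Q hfC).resolve_left hfe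
  refine ⟨f, hfQ, fun hfP ↦ hf (M.mem_closure_of_mem' ⟨hfP, hfe⟩ (hQ.subset_ground hfQ)),
    hP.exchange_base_of_notMem_closure he hf (hQ.subset_ground hfQ), ?_⟩
  apply hQ.exchange_isBase_of_indep heQ
  have := (hQ.indep.mem_fundCircuit_iff (by rwa [hQ.closure_eq]) heQ).1 hfC
  rwa [insert_sdiff_of_notMem] at this
  exact fun h ↦ hfe h.symm

/-! ### Local rules for swaps at one base -/

/-- Replacing the elements of `X` by those of `Y` turns `A` into a base. -/
def IsSwap (M : Matroid α) (A X Y : Set α) : Prop := M.IsBase (A \ X ∪ Y)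

theorem IsBase.isBase_insert_sdiff_iff (hK : M.IsBase K) (hx : x ∈ K) (hb : b ∈ M.E) (hbK : b ∉ K) :
    M.IsBase (insert b (K \ {x})) ↔ b ∉ M.closure (K \ {x}) := by
  refine ⟨fun h ↦ ?_, fun h ↦ hK.exchange_base_of_notMem_closure hx h hb⟩
  have := h.indep.notMem_closure_sdiff_of_mem (mem_insert b _)
  rwa [insert_sdiff_of_mem _ (mem_singleton b), sdiff_singleton_eq_self (by simp [hbK])] at this

theorem IsBase.isSwap_singleton_iff (hA : M.IsBase A) (hx : x ∈ A) (hb : b ∈ M.E \ A) :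
    M.IsSwap A {x} {b} ↔ b ∉ M.closure (A \ {x}) := by
  rw [IsSwap, union_singleton, hA.isBase_insert_sdiff_iff hx hb.1 hb.2]

/-- Closure commutes with intersection on subsets of an independent set. -/
theorem Indep.mem_closure_sdiff_pair (hI : M.Indep I) (hx : b ∈ M.closure (I \ {x}))
    (hy : b ∈ M.closure (I \ {y})) : b ∈ M.closure (I \ {x, y}) := by
  have e : I \ {x, y} = I \ {x} ∩ (I \ {y}) := by grind
  rw [e, (hI.subset (union_subset sdiff_subset sdiff_subset)).closure_inter_eq_inter_closure]
  exact ⟨hx, hy⟩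

/-- If `b` and `c` both lay in the hyperplane spanned by `A \ {x}`, so would the whole new base. -/
theorem IsSwap.exists_singleton (h : M.IsSwap A {x, y} {b, c}) (hA : M.IsBase A) (hx : x ∈ A)
    (hb : b ∈ M.E \ A) (hc : c ∈ M.E \ A) : M.IsSwap A {x} {b} ∨ M.IsSwap A {x} {c} := by
  rw [hA.isSwap_singleton_iff hx hb, hA.isSwap_singleton_iff hx hc]
  by_contra! hcon
  refine hA.indep.notMem_closure_sdiff_of_mem hx ?_
  have hsub : A \ {x, y} ∪ {b, c} ⊆ M.closure (A \ {x}) := by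
    refine union_subset ?_ (by grind)
    exact (show A \ {x, y} ⊆ A \ {x} by grind).trans
      (M.subset_closure _ (sdiff_subset.trans hA.subset_ground))
  have := M.closure_subset_closure_of_subset_closure hsub
  rw [h.closure_eq] at this
  exact this (hA.subset_ground hx)

/-- Otherwise `b` would depend on `A \ {x, y}`, a part of the new base. -/
theorem IsSwap.exists_singleton' (h : M.IsSwap A {x, y} {b, c}) (hA : M.IsBase A) (hx : x ∈ A)
    (hy : y ∈ A) (hb : b ∈ M.E \ A) :
    M.IsSwap A {x} {b} ∨ M.IsSwap A {y} {b} := by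
  rw [hA.isSwap_singleton_iff hx hb, hA.isSwap_singleton_iff hy hb]
  by_contra! hcon
  have h : M.IsBase (A \ {x, y} ∪ {b, c}) := h
  refine h.indep.notMem_closure_sdiff_of_mem (e := b) (by grind) ?_
  exact M.closure_subset_closure (by grind) (hA.indep.mem_closure_sdiff_pair hcon.1 hcon.2)

/-- The triangular case of a 2 × 2 minor: after `y` is traded for `c`, removing `x` leaves a set
inside the closure of `A \ {x}`, which misses `b`. -/
theorem IsBase.isSwap_pair_of_singleton (hA : M.IsBase A) (hx : x ∈ A) (hxy : x ≠ y)
    (hb : b ∈ M.E \ A) (hc : c ∈ M.E \ A) (hxb : M.IsSwap A {x} {b}) (hyc : M.IsSwap A {y} {c})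
    (hxc : ¬ M.IsSwap A {x} {c}) : M.IsSwap A {x, y} {b, c} := by
  rw [hA.isSwap_singleton_iff hx hb] at hxb
  rw [hA.isSwap_singleton_iff hx hc, not_not] at hxc
  have hbc : b ≠ c := by rintro rfl; contradiction
  have hK : M.IsBase (A \ {y} ∪ {c}) := hyc
  have h := (hK.isBase_insert_sdiff_iff (x := x) (b := b) (by grind) hb.1 (by grind)).2 ?_
  · have e : A \ {x, y} ∪ {b, c} = insert b ((A \ {y} ∪ {c}) \ {x}) := by grind
    rwa [IsSwap, e]
  · refine fun h ↦ hxb (M.closure_subset_closure_of_subset_closure ?_ h)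
    have := M.subset_closure (A \ {x}) (sdiff_subset.trans hA.subset_ground)
    grind

/-- If both failed, the new base without `z` would span `x` and `y`, hence `A \ {z}` together with
`b` and `c`, and so everything. -/
theorem IsSwap.pair_trans (h : M.IsSwap A {x, y} {b, c}) (hA : M.IsBase A) (hx : x ∈ A)
    (hy : y ∈ A) (hz : z ∈ A) (hxz : x ≠ z) (hyz : y ≠ z) (hxy : x ≠ y)
    (hb : b ∈ M.E \ A) (hc : c ∈ M.E \ A)
    (hzbc : M.IsSwap A {z} {b} ∨ M.IsSwap A {z} {c}) :
    M.IsSwap A {x, z} {b, c} ∨ M.IsSwap A {y, z} {b, c} := by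
  by_contra! hcon
  have hK : M.IsBase (A \ {x, y} ∪ {b, c}) := h
  have hKz : (A \ {x, y} ∪ {b, c}) \ {z} ⊆ M.closure ((A \ {x, y} ∪ {b, c}) \ {z}) :=
    M.subset_closure _ (sdiff_subset.trans hK.subset_ground)
  have e1 : A \ {x, z} ∪ {b, c} = insert y ((A \ {x, y} ∪ {b, c}) \ {z}) := by grind
  have e2 : A \ {y, z} ∪ {b, c} = insert x ((A \ {x, y} ∪ {b, c}) \ {z}) := by grind
  have h1 := hcon.1
  have h2 := hcon.2
  rw [IsSwap, e1, hK.isBase_insert_sdiff_iff (by grind) (hA.subset_ground hy) (by grind),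
    not_not] at h1
  rw [IsSwap, e2, hK.isBase_insert_sdiff_iff (by grind) (hA.subset_ground hx) (by grind),
    not_not] at h2
  have key (w : α) (hw : w = b ∨ w = c) : ¬ M.IsSwap A {z} {w} := fun hzw ↦ by
    have hzw : M.IsBase (A \ {z} ∪ {w}) := hzw
    refine hK.indep.notMem_closure_sdiff_of_mem (e := z) (by grind) ?_
    have := M.closure_subset_closure_of_subset_closure
      (X := A \ {z} ∪ {w}) (Y := (A \ {x, y} ∪ {b, c}) \ {z}) (by grind)
    rw [hzw.closure_eq] at this
    exact this (hA.subset_ground hz)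
  exact hzbc.elim (key b (.inl rfl)) (key c (.inr rfl))

/-- The new base without `d` spans a hyperplane, which would contain `A` if it contained `x`, `y`
and `z`. -/
theorem IsSwap.exists_pair (h : M.IsSwap A {x, y, z} {b, c, d}) (hA : M.IsBase A)
    (hx : x ∈ A) (hy : y ∈ A) (hz : z ∈ A) (hxy : x ≠ y) (hxz : x ≠ z) (hyz : y ≠ z)
    (hb : b ∈ M.E \ A) (hc : c ∈ M.E \ A) (hd : d ∈ M.E \ A) (hbd : b ≠ d) (hcd : c ≠ d) :
    M.IsSwap A {x, y} {b, c} ∨ M.IsSwap A {x, z} {b, c} ∨ M.IsSwap A {y, z} {b, c} := by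
  by_contra! hcon
  have hK : M.IsBase (A \ {x, y, z} ∪ {b, c, d}) := h
  have hKd : (A \ {x, y, z} ∪ {b, c, d}) \ {d} ⊆
      M.closure ((A \ {x, y, z} ∪ {b, c, d}) \ {d}) :=
    M.subset_closure _ (sdiff_subset.trans hK.subset_ground)
  obtain ⟨h1, h2, h3⟩ := hcon
  have e1 : A \ {x, y} ∪ {b, c} = insert z ((A \ {x, y, z} ∪ {b, c, d}) \ {d}) := by grind
  have e2 : A \ {x, z} ∪ {b, c} = insert y ((A \ {x, y, z} ∪ {b, c, d}) \ {d}) := by grind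
  have e3 : A \ {y, z} ∪ {b, c} = insert x ((A \ {x, y, z} ∪ {b, c, d}) \ {d}) := by grind
  rw [IsSwap, e1, hK.isBase_insert_sdiff_iff (by grind) (hA.subset_ground hz) (by grind),
    not_not] at h1
  rw [IsSwap, e2, hK.isBase_insert_sdiff_iff (by grind) (hA.subset_ground hy) (by grind),
    not_not] at h2
  rw [IsSwap, e3, hK.isBase_insert_sdiff_iff (by grind) (hA.subset_ground hx) (by grind),
    not_not] at h3
  refine hK.indep.notMem_closure_sdiff_of_mem (e := d) (by grind) ?_
  have := M.closure_subset_closure_of_subset_closure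
    (X := A) (Y := (A \ {x, y, z} ∪ {b, c, d}) \ {d}) (by grind)
  rw [hA.closure_eq] at this
  exact this hd.1

/-- The closure of `A \ {z}` contains `b` and `c`, hence the new base without `z`, but not `d`. -/
theorem IsSwap.triple_of_singleton (h : M.IsSwap A {x, y} {b, c}) (hA : M.IsBase A)
    (hz : z ∈ A) (hxz : x ≠ z) (hyz : y ≠ z)
    (hb : b ∈ M.E \ A) (hc : c ∈ M.E \ A) (hd : d ∈ M.E \ A) (hbd : b ≠ d) (hcd : c ≠ d)
    (hzd : M.IsSwap A {z} {d}) (hzb : ¬ M.IsSwap A {z} {b}) (hzc : ¬ M.IsSwap A {z} {c}) :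
    M.IsSwap A {x, y, z} {d, b, c} := by
  rw [hA.isSwap_singleton_iff hz hd] at hzd
  rw [hA.isSwap_singleton_iff hz hb, not_not] at hzb
  rw [hA.isSwap_singleton_iff hz hc, not_not] at hzc
  have hK : M.IsBase (A \ {x, y} ∪ {b, c}) := h
  have e : A \ {x, y, z} ∪ {d, b, c} = insert d ((A \ {x, y} ∪ {b, c}) \ {z}) := by grind
  rw [IsSwap, e, hK.isBase_insert_sdiff_iff (by grind) hd.1 (by grind)]
  refine fun h ↦ hzd (M.closure_subset_closure_of_subset_closure ?_ h)
  have := M.subset_closure (A \ {z}) (sdiff_subset.trans hA.subset_ground)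
  grind

/-- If both failed, `d` would depend on the new base without `z` and `a`. Since `b` depends on `A \
{z, a}`, `d` would depend on `A \ {z, a} ∪ {c}`, against the swap of `{z, a}` with `{c, d}`. -/
theorem IsSwap.exists_triple (h : M.IsSwap A {x, y} {b, c}) (hA : M.IsBase A)
    (ha : a ∈ A) (hz : z ∈ A) (hxz : x ≠ z) (hyz : y ≠ z) (hxa : x ≠ a) (hya : y ≠ a)
    (hb : b ∈ M.E \ A) (hc : c ∈ M.E \ A) (hd : d ∈ M.E \ A) (hbd : b ≠ d) (hcd : c ≠ d)
    (hza : M.IsSwap A {z, a} {c, d}) (hzb : ¬ M.IsSwap A {z} {b}) (hab : ¬ M.IsSwap A {a} {b}) :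
    M.IsSwap A {x, y, z} {b, c, d} ∨ M.IsSwap A {x, y, a} {b, c, d} := by
  by_contra! hcon
  obtain ⟨h1, h2⟩ := hcon
  rw [hA.isSwap_singleton_iff hz hb, not_not] at hzb
  rw [hA.isSwap_singleton_iff ha hb, not_not] at hab
  have hK : M.IsBase (A \ {x, y} ∪ {b, c}) := h
  have e1 : A \ {x, y, z} ∪ {b, c, d} = insert d ((A \ {x, y} ∪ {b, c}) \ {z}) := by grind
  have e2 : A \ {x, y, a} ∪ {b, c, d} = insert d ((A \ {x, y} ∪ {b, c}) \ {a}) := by grind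
  rw [IsSwap, e1, hK.isBase_insert_sdiff_iff (by grind) hd.1 (by grind), not_not] at h1
  rw [IsSwap, e2, hK.isBase_insert_sdiff_iff (by grind) hd.1 (by grind), not_not] at h2
  have h3 := hK.indep.mem_closure_sdiff_pair h1 h2
  have h4 := hA.indep.mem_closure_sdiff_pair hzb hab
  have hza : M.IsBase (A \ {z, a} ∪ {c, d}) := hza
  refine hza.indep.notMem_closure_sdiff_of_mem (e := d) (by grind)
    (M.closure_subset_closure_of_subset_closure ?_ h3)
  have h5 : A \ {z, a} ⊆ (A \ {z, a} ∪ {c, d}) \ {d} := by grind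
  have h6 := M.closure_subset_closure h5
  have h7 := M.subset_closure ((A \ {z, a} ∪ {c, d}) \ {d})
    (sdiff_subset.trans hza.subset_ground)
  grind

/-- Local properties shared by the relations "exchanging `X` and `Y` preserves a base" seen from
either of two disjoint bases `A ⊇ X` and `B ⊇ Y`. -/
structure SwapRules (s : Set α → Set α → Prop) (A B : Set α) : Prop where
  row : ∀ x ∈ A, ∀ y ∈ A, ∀ b ∈ B, ∀ c ∈ B, s {x, y} {b, c} → s {x} {b} ∨ s {x} {c}
  col : ∀ x ∈ A, ∀ y ∈ A, ∀ b ∈ B, ∀ c ∈ B, s {x, y} {b, c} → s {x} {b} ∨ s {y} {b}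
  pair : ∀ x ∈ A, ∀ y ∈ A, x ≠ y → ∀ b ∈ B, ∀ c ∈ B, s {x} {b} → s {y} {c} → ¬ s {x} {c} →
    s {x, y} {b, c}
  trans : ∀ x ∈ A, ∀ y ∈ A, ∀ z ∈ A, x ≠ y → x ≠ z → y ≠ z → ∀ b ∈ B, ∀ c ∈ B,
    s {x, y} {b, c} → s {z} {b} ∨ s {z} {c} → s {x, z} {b, c} ∨ s {y, z} {b, c}
  exists_pair : ∀ x ∈ A, ∀ y ∈ A, ∀ z ∈ A, x ≠ y → x ≠ z → y ≠ z →
    ∀ b ∈ B, ∀ c ∈ B, ∀ d ∈ B, b ≠ d → c ≠ d → s {x, y, z} {b, c, d} →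
    s {x, y} {b, c} ∨ s {x, z} {b, c} ∨ s {y, z} {b, c}
  triple : ∀ x ∈ A, ∀ y ∈ A, ∀ z ∈ A, x ≠ z → y ≠ z →
    ∀ b ∈ B, ∀ c ∈ B, ∀ d ∈ B, b ≠ d → c ≠ d → s {x, y} {b, c} → s {z} {d} →
    ¬ s {z} {b} → ¬ s {z} {c} → s {x, y, z} {d, b, c}
  exists_triple : ∀ x ∈ A, ∀ y ∈ A, ∀ z ∈ A, ∀ a ∈ A, x ≠ z → y ≠ z → x ≠ a → y ≠ a →
    ∀ b ∈ B, ∀ c ∈ B, ∀ d ∈ B, b ≠ d → c ≠ d → s {x, y} {b, c} → s {z, a} {c, d} →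
    ¬ s {z} {b} → ¬ s {a} {b} → s {x, y, z} {b, c, d} ∨ s {x, y, a} {b, c, d}

theorem IsBase.swapRules (hA : M.IsBase A) (hBE : B ⊆ M.E) (hAB : Disjoint A B) :
    SwapRules (M.IsSwap A) A B := by
  have hB : ∀ b ∈ B, b ∈ M.E \ A := fun b hb ↦ ⟨hBE hb, fun h ↦ disjoint_left.1 hAB h hb⟩
  constructor
  · exact fun x hx y _ b hb c hc h ↦ h.exists_singleton hA hx (hB b hb) (hB c hc)
  · exact fun x hx y hy b hb c _ h ↦ h.exists_singleton' hA hx hy (hB b hb)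
  · exact fun x hx y _ hxy b hb c hc ↦
      hA.isSwap_pair_of_singleton hx hxy (hB b hb) (hB c hc)
  · exact fun x hx y hy z hz hxy hxz hyz b hb c hc h ↦
      h.pair_trans hA hx hy hz hxz hyz hxy (hB b hb) (hB c hc)
  · exact fun x hx y hy z hz hxy hxz hyz b hb c hc d hd hbd hcd h ↦
      h.exists_pair hA hx hy hz hxy hxz hyz (hB b hb) (hB c hc) (hB d hd) hbd hcd
  · exact fun x _ y _ z hz hxz hyz b hb c hc d hd hbd hcd h ↦
      h.triple_of_singleton hA hz hxz hyz (hB b hb) (hB c hc) (hB d hd) hbd hcd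
  · exact fun x _ y _ z hz a ha hxz hyz hxa hya b hb c hc d hd hbd hcd h ↦
      h.exists_triple hA ha hz hxz hyz hxa hya (hB b hb) (hB c hc) (hB d hd) hbd hcd

theorem SwapRules.congr {s t : Set α → Set α → Prop} (h : SwapRules s A B)
    (hst : ∀ X ⊆ A, ∀ Y ⊆ B, (s X Y ↔ t X Y)) : SwapRules t A B := by
  have h1 : ∀ x ∈ A, ∀ b ∈ B, (s {x} {b} ↔ t {x} {b}) := fun x hx b hb ↦
    hst _ (by grind) _ (by grind)
  have h2 : ∀ x ∈ A, ∀ y ∈ A, ∀ b ∈ B, ∀ c ∈ B, (s {x, y} {b, c} ↔ t {x, y} {b, c}) :=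
    fun x hx y hy b hb c hc ↦ hst _ (by grind) _ (by grind)
  have h3 : ∀ x ∈ A, ∀ y ∈ A, ∀ z ∈ A, ∀ b ∈ B, ∀ c ∈ B, ∀ d ∈ B,
      (s {x, y, z} {b, c, d} ↔ t {x, y, z} {b, c, d}) :=
    fun x hx y hy z hz b hb c hc d hd ↦ hst _ (by grind) _ (by grind)
  constructor
  · intro x hx y hy b hb c hc
    simpa only [h1, h2, hx, hy, hb, hc] using h.row x hx y hy b hb c hc
  · intro x hx y hy b hb c hc
    simpa only [h1, h2, hx, hy, hb, hc] using h.col x hx y hy b hb c hc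
  · intro x hx y hy hxy b hb c hc
    simpa only [h1, h2, hx, hy, hb, hc] using h.pair x hx y hy hxy b hb c hc
  · intro x hx y hy z hz hxy hxz hyz b hb c hc
    simpa only [h1, h2, hx, hy, hz, hb, hc] using h.trans x hx y hy z hz hxy hxz hyz b hb c hc
  · intro x hx y hy z hz hxy hxz hyz b hb c hc d hd
    simpa only [h2, h3, hx, hy, hz, hb, hc, hd] using
      h.exists_pair x hx y hy z hz hxy hxz hyz b hb c hc d hd
  · intro x hx y hy z hz hxz hyz b hb c hc d hd
    simpa only [h1, h2, h3, hx, hy, hz, hb, hc, hd] using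
      h.triple x hx y hy z hz hxz hyz b hb c hc d hd
  · intro x hx y hy z hz a ha hxz hyz hxa hya b hb c hc d hd
    simpa only [h1, h2, h3, hx, hy, hz, ha, hb, hc, hd] using
      h.exists_triple x hx y hy z hz a ha hxz hyz hxa hya b hb c hc d hd

/-- The rules seen from `B`, by duality in the restriction to `A ∪ B`. -/
theorem IsBase.swapRules_symm (hA : M.IsBase A) (hB : M.IsBase B) (hAB : Disjoint A B) :
    SwapRules (fun X Y ↦ M.IsSwap B Y X) A B := by
  have hE : A ∪ B ⊆ M.E := union_subset hA.subset_ground hB.subset_ground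
  have hsp : M.Spanning (A ∪ B) := hA.spanning_of_superset subset_union_left hE
  have hbase : ∀ S ⊆ A ∪ B, ((M ↾ (A ∪ B))✶.IsBase S ↔ M.IsBase ((A ∪ B) \ S)) := fun S hS ↦ by
    rw [dual_isBase_iff (by simpa using hS), hsp.isBase_restrict_iff]
    simp
  have hA' : (M ↾ (A ∪ B))✶.IsBase A := by
    rwa [hbase _ subset_union_left, union_sdiff_cancel_left (disjoint_iff.1 hAB).le]
  refine (hA'.swapRules (B := B) (by simp) hAB).congr fun X hX Y hY ↦ ?_
  have e : (A ∪ B) \ (A \ X ∪ Y) = B \ Y ∪ X := by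
    ext v
    have h1 := @hX v
    have h2 := @hY v
    have h3 : v ∈ A → v ∉ B := fun h ↦ disjoint_left.1 hAB h
    simp only [mem_sdiff, mem_union]
    tauto
  rw [IsSwap, IsSwap, hbase _ (by grind), e]

/-! ### Combinatorial consequences of the rules -/

namespace SwapRules

variable {s t : Set α → Set α → Prop}

/-- `exists_pair` supplies one pair, and `trans` carries it to a second one through the third
element. -/
theorem two_pairs (h : SwapRules s A B) (hx : x ∈ A) (hy : y ∈ A) (hz : z ∈ A)
    (hxy : x ≠ y) (hxz : x ≠ z) (hyz : y ≠ z) (hb : b ∈ B) (hc : c ∈ B) (hd : d ∈ B)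
    (hbd : b ≠ d) (hcd : c ≠ d) (h3 : s {x, y, z} {b, c, d})
    (hl : ∀ u ∈ A, s {u} {b} ∨ s {u} {c}) :
    (s {x, y} {b, c} ∧ s {x, z} {b, c}) ∨ (s {x, y} {b, c} ∧ s {y, z} {b, c}) ∨
      (s {x, z} {b, c} ∧ s {y, z} {b, c}) := by
  have h1 := h.exists_pair x hx y hy z hz hxy hxz hyz b hb c hc d hd hbd hcd h3
  have h4 := h.trans x hx y hy z hz hxy hxz hyz b hb c hc
  have h5 := h.trans x hx z hz y hy hxz hxy hyz.symm b hb c hc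
  have h6 := h.trans y hy z hz x hx hyz hxy.symm hxz.symm b hb c hc
  rw [pair_comm z y] at h5
  rw [pair_comm y x, pair_comm z x] at h6
  have := hl x hx
  have := hl y hy
  have := hl z hz
  clear h h3 hl
  grind

/-- If `x` is exchangeable with neither `c` nor `d`, then a triple exchange of `{x, y, z}` with
`{b, c, d}` restricts to one of `{y, z}` with `{c, d}`. -/
theorem pair_of_triple (h : SwapRules s A B) (hx : x ∈ A) (hy : y ∈ A) (hz : z ∈ A)
    (hxy : x ≠ y) (hxz : x ≠ z) (hyz : y ≠ z) (hb : b ∈ B) (hc : c ∈ B) (hd : d ∈ B)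
    (hbc : b ≠ c) (hbd : b ≠ d) (h3 : s {x, y, z} {b, c, d}) (hxc : ¬ s {x} {c})
    (hxd : ¬ s {x} {d}) : s {y, z} {c, d} := by
  rw [insert_comm b c, pair_comm b d] at h3
  have h1 := h.exists_pair x hx y hy z hz hxy hxz hyz c hc d hd b hb hbc.symm hbd.symm h3
  have h2 := h.row x hx y hy c hc d hd
  have h4 := h.row x hx z hz c hc d hd
  tauto

/-- Two elements of `A` that can be jointly exchanged with `{b, c}`, without either of them being
exchangeable with `b` or `c`, are in opposite position with respect to `b` and `c`. -/
theorem opposite (hs : SwapRules s A B) (ht : SwapRules t A B) (hx : x ∈ A) (hy : y ∈ A)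
    (hb : b ∈ B) (hc : c ∈ B) (hsxy : s {x, y} {b, c}) (htxy : t {x, y} {b, c})
    (hno : ∀ u ∈ ({x, y} : Set α), ∀ v ∈ ({b, c} : Set α), ¬ (s {u} {v} ∧ t {u} {v})) :
    (s {x} {b} ∧ ¬ s {x} {c} ∧ ¬ t {x} {b} ∧ t {x} {c} ∧
      ¬ s {y} {b} ∧ s {y} {c} ∧ t {y} {b} ∧ ¬ t {y} {c}) ∨
    (s {y} {b} ∧ ¬ s {y} {c} ∧ ¬ t {y} {b} ∧ t {y} {c} ∧
      ¬ s {x} {b} ∧ s {x} {c} ∧ t {x} {b} ∧ ¬ t {x} {c}) := by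
  have h1 := hs.col x hx y hy b hb c hc hsxy
  have h2 := hs.col x hx y hy c hc b hb (by rwa [pair_comm c b])
  have h3 := hs.row x hx y hy b hb c hc hsxy
  have h4 := hs.row y hy x hx b hb c hc (by rwa [pair_comm y x])
  have h5 := ht.row x hx y hy b hb c hc htxy
  have h6 := ht.row y hy x hx b hb c hc (by rwa [pair_comm y x])
  have := hno x (by simp) b (by simp)
  have := hno x (by simp) c (by simp)
  have := hno y (by simp) b (by simp)
  have := hno y (by simp) c (by simp)
  clear hno hsxy htxy hs ht
  grind

theorem complementary_of_pair (hs : SwapRules s A B) (ht : SwapRules t A B)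
    (hx : x ∈ A) (hy : y ∈ A) (hz : z ∈ A) (hxy : x ≠ y) (hxz : x ≠ z) (hyz : y ≠ z)
    (hb : b ∈ B) (hc : c ∈ B)
    (hsl : ∀ u ∈ A, s {u} {b} ∨ s {u} {c}) (htl : ∀ u ∈ A, t {u} {b} ∨ t {u} {c})
    (hsxy : s {x, y} {b, c}) (htxy : t {x, y} {b, c})
    (hsz : s {x, z} {b, c} ∨ s {y, z} {b, c}) (htz : t {x, z} {b, c} ∨ t {y, z} {b, c})
    (hno : ∀ u ∈ ({x, y, z} : Set α), ∀ v ∈ ({x, y, z} : Set α), u ≠ v →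
      s {u, v} {b, c} → t {u, v} {b, c} → ∀ w ∈ ({b, c} : Set α), ¬ (s {u} {w} ∧ t {u} {w})) :
    ∃ p q r, ({p, q, r} : Set α) = {x, y, z} ∧ p ≠ q ∧ p ≠ r ∧ q ≠ r ∧
      (s {p} {b} ∧ ¬ s {p} {c} ∧ ¬ t {p} {b} ∧ t {p} {c}) ∧
      (¬ s {q} {b} ∧ s {q} {c} ∧ t {q} {b} ∧ ¬ t {q} {c}) ∧
      (s {r} {b} ↔ ¬ s {r} {c}) ∧ (t {r} {b} ↔ ¬ t {r} {c}) := by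
  have hno' : ∀ u ∈ ({x, y, z} : Set α), ∀ v ∈ ({x, y, z} : Set α), u ≠ v →
      s {u, v} {b, c} → t {u, v} {b, c} →
      ∀ a ∈ ({u, v} : Set α), ∀ w ∈ ({b, c} : Set α), ¬ (s {a} {w} ∧ t {a} {w}) := by
    rintro u hu v hv huv h1 h2 a (rfl | rfl) w hw
    · exact hno _ hu _ hv huv h1 h2 w hw
    · rw [pair_comm] at h1 h2
      exact hno _ hv _ hu huv.symm h1 h2 w hw
  have hopp := hs.opposite ht hx hy hb hc hsxy htxy
    (hno' x (by simp) y (by simp) hxy hsxy htxy)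
  -- If `z` swapped with both `b` and `c` under one relation, `pair` would give that relation for
  -- `{x, z}` and `{y, z}`. The other relation holds for one of these, and there `opposite` forbids
  -- the double swap.
  have hz' : (s {z} {b} ↔ ¬ s {z} {c}) ∧ (t {z} {b} ↔ ¬ t {z} {c}) := by
    have o1 := fun h1 h2 ↦ hs.opposite ht hx hz hb hc h1 h2
      (hno' x (by simp) z (by simp) hxz h1 h2)
    have o2 := fun h1 h2 ↦ hs.opposite ht hy hz hb hc h1 h2
      (hno' y (by simp) z (by simp) hyz h1 h2)
    have s1 := hs.pair x hx z hz hxz b hb c hc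
    have s2 := hs.pair x hx z hz hxz c hc b hb
    have s3 := hs.pair y hy z hz hyz b hb c hc
    have s4 := hs.pair y hy z hz hyz c hc b hb
    have t1 := ht.pair x hx z hz hxz b hb c hc
    have t2 := ht.pair x hx z hz hxz c hc b hb
    have t3 := ht.pair y hy z hz hyz b hb c hc
    have t4 := ht.pair y hy z hz hyz c hc b hb
    rw [pair_comm c b] at s2 s4 t2 t4
    have := hsl z hz
    have := htl z hz
    grind
  obtain h | h := hopp
  · exact ⟨x, y, z, rfl, hxy, hxz, hyz, by tauto⟩
  · exact ⟨y, x, z, insert_comm _ _ _, hxy.symm, hyz, hxz, by tauto⟩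

/-- The shape of the relations between a triple exchange and two of its elements, when it does not
extend a serial exchange of two elements. -/
theorem complementary (hs : SwapRules s A B) (ht : SwapRules t A B)
    (hx : x ∈ A) (hy : y ∈ A) (hz : z ∈ A) (hxy : x ≠ y) (hxz : x ≠ z) (hyz : y ≠ z)
    (hb : b ∈ B) (hc : c ∈ B) (hd : d ∈ B) (hbd : b ≠ d) (hcd : c ≠ d)
    (hsl : ∀ u ∈ A, s {u} {b} ∨ s {u} {c}) (htl : ∀ u ∈ A, t {u} {b} ∨ t {u} {c})
    (hs3 : s {x, y, z} {b, c, d}) (ht3 : t {x, y, z} {b, c, d})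
    (hno : ∀ u ∈ ({x, y, z} : Set α), ∀ v ∈ ({x, y, z} : Set α), u ≠ v →
      s {u, v} {b, c} → t {u, v} {b, c} → ∀ w ∈ ({b, c} : Set α), ¬ (s {u} {w} ∧ t {u} {w})) :
    ∃ p q r, ({p, q, r} : Set α) = {x, y, z} ∧ p ≠ q ∧ p ≠ r ∧ q ≠ r ∧
      (s {p} {b} ∧ ¬ s {p} {c} ∧ ¬ t {p} {b} ∧ t {p} {c}) ∧
      (¬ s {q} {b} ∧ s {q} {c} ∧ t {q} {b} ∧ ¬ t {q} {c}) ∧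
      (s {r} {b} ↔ ¬ s {r} {c}) ∧ (t {r} {b} ↔ ¬ t {r} {c}) := by
  have hs2 := hs.two_pairs hx hy hz hxy hxz hyz hb hc hd hbd hcd hs3 hsl
  have ht2 := ht.two_pairs hx hy hz hxy hxz hyz hb hc hd hbd hcd ht3 htl
  -- Each relation holds for two of the three pairs, so some pair serves both.
  have key : (s {x, y} {b, c} ∧ t {x, y} {b, c}) ∨ (s {x, z} {b, c} ∧ t {x, z} {b, c}) ∨
      (s {y, z} {b, c} ∧ t {y, z} {b, c}) := by tauto
  obtain ⟨h1, h2⟩ | ⟨h1, h2⟩ | ⟨h1, h2⟩ := key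
  · exact hs.complementary_of_pair ht hx hy hz hxy hxz hyz hb hc hsl htl h1 h2
      (by tauto) (by tauto) hno
  · have e : ({x, z, y} : Set α) = {x, y, z} := by grind
    rw [← e] at hno ⊢
    refine hs.complementary_of_pair ht hx hz hy hxz hxy hyz.symm hb hc hsl htl h1 h2
      ?_ ?_ hno <;> rw [pair_comm z y] <;> tauto
  · have e : ({y, z, x} : Set α) = {x, y, z} := by grind
    rw [← e] at hno ⊢
    refine hs.complementary_of_pair ht hy hz hx hyz hxy.symm hxz.symm hb hc hsl htl h1 h2
      ?_ ?_ hno <;> rw [pair_comm y x, pair_comm z x] <;> tauto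

end SwapRules

/-! ### Symmetric exchanges between disjoint bases -/

/-- Exchanging `X ⊆ A` and `Y ⊆ B` turns the bases `A` and `B` into bases. -/
def IsBiSwap (M : Matroid α) (A B X Y : Set α) : Prop := M.IsSwap A X Y ∧ M.IsSwap B Y X

theorem isBiSwap_comm : M.IsBiSwap A B X Y ↔ M.IsBiSwap B A Y X := and_comm

/-- `A` and `B` are disjoint bases without a serial symmetric exchange of three elements. -/
structure NoTripleExchange (M : Matroid α) (A B : Set α) : Prop where
  left : M.IsBase A
  right : M.IsBase B
  disjoint : Disjoint A B
  not_isBiSwap : ∀ a₁ ∈ A, ∀ a₂ ∈ A, ∀ a₃ ∈ A, a₁ ≠ a₂ → a₁ ≠ a₃ → a₂ ≠ a₃ →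
    ∀ b₁ ∈ B, ∀ b₂ ∈ B, ∀ b₃ ∈ B, b₁ ≠ b₂ → b₁ ≠ b₃ → b₂ ≠ b₃ →
    M.IsBiSwap A B {a₁} {b₁} → M.IsBiSwap A B {a₁, a₂} {b₁, b₂} →
    ¬ M.IsBiSwap A B {a₁, a₂, a₃} {b₁, b₂, b₃}

/-- A symmetric exchange of `{x, y}` and `{b, c}` that arises from two serial exchanges. -/
def IsSerialPair (M : Matroid α) (A B : Set α) (x y b c : α) : Prop :=
  M.IsBiSwap A B {x, y} {b, c} ∧
    ∃ u ∈ ({x, y} : Set α), ∃ v ∈ ({b, c} : Set α), M.IsBiSwap A B {u} {v}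

/-- Every element of `A` can replace `b` or `c` in `B`, and can be replaced by `b` or `c` in `A`. -/
def Covers (M : Matroid α) (A B : Set α) (b c : α) : Prop :=
  (∀ u ∈ A, M.IsSwap A {u} {b} ∨ M.IsSwap A {u} {c}) ∧
    ∀ u ∈ A, M.IsSwap B {b} {u} ∨ M.IsSwap B {c} {u}

theorem Covers.symm (h : M.Covers A B b c) : M.Covers A B c b :=
  ⟨fun u hu ↦ (h.1 u hu).symm, fun u hu ↦ (h.2 u hu).symm⟩

/-- The symmetric exchange of a further element after a symmetric exchange of two elements. -/
theorem IsBiSwap.exchange (h : M.IsBiSwap A B {x, y} {b, c}) (hAB : Disjoint A B)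
    (hx : x ∈ A) (hy : y ∈ A) (hz : z ∈ A) (hxy : x ≠ y) (hxz : x ≠ z) (hyz : y ≠ z)
    (hb : b ∈ B) (hc : c ∈ B) :
    M.IsBiSwap A B {x, z} {b, c} ∨ M.IsBiSwap A B {y, z} {b, c} ∨
      ∃ d ∈ B, b ≠ d ∧ c ≠ d ∧ M.IsBiSwap A B {x, y, z} {b, c, d} := by
  have hdis : ∀ u ∈ A, ∀ v ∈ B, u ≠ v := fun u hu v hv ↦ hAB.ne_of_mem hu hv
  obtain ⟨h1, h2⟩ := h
  obtain ⟨f, hf, hf', h3, h4⟩ := IsBase.exists_symmetric_exchange (e := z) h1 h2 (by grind)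
    (by grind)
  obtain rfl | hfx := eq_or_ne f x
  · right; left
    constructor
    · rw [IsSwap]; convert h3 using 1; grind
    · rw [IsSwap]; convert h4 using 1; grind
  obtain rfl | hfy := eq_or_ne f y
  · left
    constructor
    · rw [IsSwap]; convert h3 using 1; grind
    · rw [IsSwap]; convert h4 using 1; grind
  · right; right
    refine ⟨f, by grind, by grind, by grind, ?_, ?_⟩
    · rw [IsSwap]; convert h3 using 1; grind
    · rw [IsSwap]; convert h4 using 1; grind

/-- Exchange `c` after `(a, b)`: a partner equal to `b` would mean that `a` and `c` are
exchangeable. -/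
theorem IsBiSwap.exists_pair (h : M.IsBiSwap A B {a} {b}) (hAB : Disjoint A B)
    (ha : a ∈ A) (hb : b ∈ B) (hc : c ∈ B) (hbc : b ≠ c) (hac : ¬ M.IsBiSwap A B {a} {c}) :
    ∃ x ∈ A, a ≠ x ∧ M.IsBiSwap A B {a, x} {b, c} := by
  have hdis : ∀ u ∈ A, ∀ v ∈ B, u ≠ v := fun u hu v hv ↦ hAB.ne_of_mem hu hv
  obtain ⟨h1, h2⟩ := h
  obtain ⟨f, hf, hf', h3, h4⟩ := IsBase.exists_symmetric_exchange (e := c) h2 h1 (by grind)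
    (by grind)
  obtain rfl | hfb := eq_or_ne f b
  · refine (hac ⟨?_, ?_⟩).elim
    · rw [IsSwap]; convert h4 using 1; grind
    · rw [IsSwap]; convert h3 using 1; grind
  · refine ⟨f, by grind, by grind, ?_, ?_⟩
    · rw [IsSwap]; convert h4 using 1; grind
    · rw [IsSwap]; convert h3 using 1; grind

theorem IsBase.exists_isBiSwap_singleton (hA : M.IsBase A) (hB : M.IsBase B)
    (hAB : Disjoint A B) (hb : b ∈ B) : ∃ a ∈ A, M.IsBiSwap A B {a} {b} := by
  obtain ⟨a, ha, -, h1, h2⟩ := hB.exists_symmetric_exchange hA hb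
    (fun h ↦ disjoint_left.1 hAB h hb)
  exact ⟨a, ha, by rwa [IsSwap, union_singleton], by rwa [IsSwap, union_singleton]⟩

theorem IsBase.exists_isBiSwap_pair [M.RankFinite] (hA : M.IsBase A) (hB : M.IsBase B)
    (hb : b ∈ B) (hc : c ∈ B) (hbc : b ≠ c) :
    ∃ x ∈ A, ∃ y ∈ A, x ≠ y ∧ M.IsBiSwap A B {x, y} {b, c} := by
  obtain ⟨X, hX, hcard, h1, h2⟩ := hA.exists_subset_exchange hB (Y := {b, c}) (by grind)
  rw [encard_pair hbc, encard_eq_two] at hcard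
  obtain ⟨x, y, hxy, rfl⟩ := hcard
  exact ⟨x, by grind, y, by grind, hxy, h1, h2⟩

theorem IsBase.exists_isBiSwap_triple [M.RankFinite] (hA : M.IsBase A) (hB : M.IsBase B)
    (hb : b ∈ B) (hc : c ∈ B) (hd : d ∈ B) (hbc : b ≠ c) (hbd : b ≠ d) (hcd : c ≠ d) :
    ∃ x ∈ A, ∃ y ∈ A, ∃ z ∈ A, x ≠ y ∧ x ≠ z ∧ y ≠ z ∧
      M.IsBiSwap A B {x, y, z} {b, c, d} := by
  obtain ⟨X, hX, hcard, h1, h2⟩ := hA.exists_subset_exchange hB (Y := {b, c, d}) (by grind)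
  rw [encard_eq_three.2 ⟨b, c, d, hbc, hbd, hcd, rfl⟩, encard_eq_three] at hcard
  obtain ⟨x, y, z, hxy, hxz, hyz, rfl⟩ := hcard
  exact ⟨x, by grind, y, by grind, z, by grind, hxy, hxz, hyz, h1, h2⟩

/-- Trade `{c, d}` after `(a, b)`. If `b` is among the partners, it returns to its original side and
drops out. -/
theorem IsBiSwap.exists_pair_or_triple [M.RankFinite] (h : M.IsBiSwap A B {a} {b})
    (hAB : Disjoint A B) (ha : a ∈ A) (hb : b ∈ B) (hc : c ∈ B) (hd : d ∈ B)
    (hbc : b ≠ c) (hbd : b ≠ d) (hcd : c ≠ d) :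
    (∃ x ∈ A, a ≠ x ∧ M.IsBiSwap A B {a, x} {c, d}) ∨
      ∃ x ∈ A, ∃ y ∈ A, a ≠ x ∧ a ≠ y ∧ x ≠ y ∧ M.IsBiSwap A B {a, x, y} {b, c, d} := by
  have hdis : ∀ u ∈ A, ∀ v ∈ B, u ≠ v := fun u hu v hv ↦ hAB.ne_of_mem hu hv
  obtain ⟨x, hx, y, hy, hxy, h1, h2⟩ := IsBase.exists_isBiSwap_pair (b := c) (c := d) h.1 h.2
    (by grind) (by grind) hcd
  rw [IsSwap] at h1 h2
  have key : ∀ x y, x ∈ A \ {a} ∪ {b} → y ∈ A \ {a} ∪ {b} → x ≠ y → x = b →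
      M.IsBase ((A \ {a} ∪ {b}) \ {x, y} ∪ {c, d}) →
      M.IsBase ((B \ {b} ∪ {a}) \ {c, d} ∪ {x, y}) →
      ∃ x ∈ A, a ≠ x ∧ M.IsBiSwap A B {a, x} {c, d} := by
    rintro x y hx hy hxy rfl h1 h2
    refine ⟨y, by grind, by grind, ?_, ?_⟩
    · rw [IsSwap]; convert h1 using 1; grind
    · rw [IsSwap]; convert h2 using 1; grind
  by_cases hxb : x = b
  · exact .inl (key x y hx hy hxy hxb h1 h2)
  by_cases hyb : y = b
  · rw [pair_comm x y] at h1 h2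
    exact .inl (key y x hy hx hxy.symm hyb h1 h2)
  · refine .inr ⟨x, by grind, y, by grind, by grind, by grind, hxy, ?_, ?_⟩
    · rw [IsSwap]; convert h1 using 1; grind
    · rw [IsSwap]; convert h2 using 1; grind

/-! ### Bases without a serial triple exchange -/

namespace NoTripleExchange

theorem symm (h : M.NoTripleExchange A B) : M.NoTripleExchange B A where
  left := h.right
  right := h.left
  disjoint := h.disjoint.symm
  not_isBiSwap := by
    simp only [isBiSwap_comm (A := B) (B := A)]
    intros
    apply h.not_isBiSwap <;> assumption

theorem not_isBiSwap_of_isSerialPair (h : M.NoTripleExchange A B)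
    (hs : M.IsSerialPair A B x y b c) (hx : x ∈ A) (hy : y ∈ A) (hz : z ∈ A) (hxy : x ≠ y)
    (hxz : x ≠ z) (hyz : y ≠ z) (hb : b ∈ B) (hc : c ∈ B) (hd : d ∈ B) (hbc : b ≠ c)
    (hbd : b ≠ d) (hcd : c ≠ d) : ¬ M.IsBiSwap A B {x, y, z} {b, c, d} := by
  obtain ⟨h2, u, rfl | rfl, v, rfl | rfl, h1⟩ := hs
  · exact h.not_isBiSwap _ hx _ hy _ hz hxy hxz hyz _ hb _ hc _ hd hbc hbd hcd h1 h2
  · rw [pair_comm b] at h2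
    rw [insert_comm b]
    exact h.not_isBiSwap _ hx _ hy _ hz hxy hxz hyz _ hc _ hb _ hd hbc.symm hcd hbd h1 h2
  · rw [pair_comm x] at h2
    rw [insert_comm x]
    exact h.not_isBiSwap _ hy _ hx _ hz hxy.symm hyz hxz _ hb _ hc _ hd hbc hbd hcd h1 h2
  · rw [pair_comm x, pair_comm b] at h2
    rw [insert_comm x, insert_comm b]
    exact h.not_isBiSwap _ hy _ hx _ hz hxy.symm hyz hxz _ hc _ hb _ hd hbc.symm hcd hbd h1 h2

theorem rules (h : M.NoTripleExchange A B) : SwapRules (M.IsSwap A) A B :=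
  h.left.swapRules h.right.subset_ground h.disjoint

theorem rules_symm (h : M.NoTripleExchange A B) : SwapRules (fun X Y ↦ M.IsSwap B Y X) A B :=
  h.left.swapRules_symm h.right h.disjoint

theorem covers (h : M.NoTripleExchange A B) (hs : M.IsSerialPair A B x y b c) (hx : x ∈ A)
    (hy : y ∈ A) (hxy : x ≠ y) (hb : b ∈ B) (hc : c ∈ B) (hbc : b ≠ c) : M.Covers A B b c := by
  have key : ∀ u ∈ A, ∃ v ∈ A, M.IsBiSwap A B {u, v} {b, c} := by
    intro u hu
    obtain rfl | hux := eq_or_ne x u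
    · exact ⟨y, hy, hs.1⟩
    obtain rfl | huy := eq_or_ne y u
    · exact ⟨x, hx, by rw [pair_comm]; exact hs.1⟩
    obtain h1 | h1 | ⟨d, hd, hbd, hcd, h1⟩ :=
      hs.1.exchange h.disjoint hx hy hu hxy hux huy hb hc
    · exact ⟨x, hx, by rwa [pair_comm]⟩
    · exact ⟨y, hy, by rwa [pair_comm]⟩
    · exact (h.not_isBiSwap_of_isSerialPair hs hx hy hu hxy hux huy hb hc hd hbc hbd hcd h1).elim
  refine ⟨fun u hu ↦ ?_, fun u hu ↦ ?_⟩ <;> obtain ⟨v, hv, h1⟩ := key u hu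
  · exact h.rules.row u hu v hv b hb c hc h1.1
  · exact h.rules_symm.row u hu v hv b hb c hc h1.2

/-- A triple exchange whose elements of `B` include two covering pairs has a rigid shape. -/
theorem shape (h : M.NoTripleExchange A B) (hx : x ∈ A) (hy : y ∈ A) (hz : z ∈ A)
    (hxy : x ≠ y) (hxz : x ≠ z) (hyz : y ≠ z) (hb : b ∈ B) (hc : c ∈ B) (hd : d ∈ B)
    (hbc : b ≠ c) (hbd : b ≠ d) (hcd : c ≠ d) (hCc : M.Covers A B b c) (hCd : M.Covers A B b d)
    (h3 : M.IsBiSwap A B {x, y, z} {b, c, d}) :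
    ∃ p q r, ({p, q, r} : Set α) = {x, y, z} ∧ p ≠ q ∧ p ≠ r ∧ q ≠ r ∧
      (M.IsSwap A {p} {b} ∧ ¬ M.IsSwap A {p} {c} ∧ ¬ M.IsSwap A {p} {d} ∧
        ¬ M.IsSwap B {b} {p} ∧ M.IsSwap B {c} {p} ∧ M.IsSwap B {d} {p}) ∧
      (¬ M.IsSwap A {q} {b} ∧ M.IsSwap A {q} {c} ∧ M.IsSwap A {q} {d} ∧
        M.IsSwap B {b} {q} ∧ ¬ M.IsSwap B {c} {q} ∧ ¬ M.IsSwap B {d} {q}) ∧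
      ¬ M.IsSwap A {r} {b} ∧ ¬ M.IsSwap B {b} {r} := by
  -- A member of such a pair exchangeable with `b` or `c` would make the pair serial, and the triple
  -- would extend it.
  have hno : ∀ c ∈ B, ∀ d ∈ B, b ≠ c → b ≠ d → c ≠ d → M.IsBiSwap A B {x, y, z} {b, c, d} →
      ∀ u ∈ ({x, y, z} : Set α), ∀ v ∈ ({x, y, z} : Set α), u ≠ v →
      M.IsSwap A {u, v} {b, c} → M.IsSwap B {b, c} {u, v} →
      ∀ w ∈ ({b, c} : Set α), ¬ (M.IsSwap A {u} {w} ∧ M.IsSwap B {w} {u}) := by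
    intro c hc d hd hbc hbd hcd h3 u hu v hv huv h1 h2 w hw h4
    obtain ⟨w', hw', huw', hvw', e⟩ : ∃ w' ∈ A, u ≠ w' ∧ v ≠ w' ∧
        ({x, y, z} : Set α) = {u, v, w'} := by
      obtain rfl | rfl | rfl := hu <;> obtain rfl | rfl | rfl := hv
      · exact (huv rfl).elim
      · exact ⟨z, hz, by grind, by grind, by grind⟩
      · exact ⟨y, hy, by grind, by grind, by grind⟩
      · exact ⟨z, hz, by grind, by grind, by grind⟩
      · exact (huv rfl).elim
      · exact ⟨x, hx, by grind, by grind, by grind⟩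
      · exact ⟨y, hy, by grind, by grind, by grind⟩
      · exact ⟨x, hx, by grind, by grind, by grind⟩
      · exact (huv rfl).elim
    rw [e] at h3
    exact h.not_isBiSwap_of_isSerialPair ⟨⟨h1, h2⟩, u, by simp, w, hw, h4⟩ (by grind) (by grind)
      hw' huv huw' hvw' hb hc hd hbc hbd hcd h3
  have h3' : M.IsBiSwap A B {x, y, z} {b, d, c} := by rwa [pair_comm d c]
  obtain ⟨p, q, r, e, hpq, hpr, hqr, hp, hq, hr⟩ := h.rules.complementary h.rules_symm hx hy hz
    hxy hxz hyz hb hc hd hbd hcd hCc.1 hCc.2 h3.1 h3.2 (hno c hc d hd hbc hbd hcd h3)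
  obtain ⟨p', q', r', e', -, -, -, hp', hq', hr'⟩ := h.rules.complementary h.rules_symm hx hy hz
    hxy hxz hyz hb hd hc hbc hcd.symm hCd.1 hCd.2 h3'.1 h3'.2
    (hno d hd c hc hbd hbc hcd.symm h3')
  have hcompl : ∀ u ∈ ({p, q, r} : Set α), (M.IsSwap A {u} {b} ↔ ¬ M.IsSwap A {u} {d}) ∧
      (M.IsSwap B {b} {u} ↔ ¬ M.IsSwap B {d} {u}) := by
    rw [e, ← e']
    rintro u (rfl | rfl | rfl)
    · exact ⟨iff_of_true hp'.1 hp'.2.1, iff_of_false hp'.2.2.1 (not_not.2 hp'.2.2.2)⟩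
    · exact ⟨iff_of_false hq'.1 (not_not.2 hq'.2.1), iff_of_true hq'.2.2.1 hq'.2.2.2⟩
    · exact hr'
  have hpA : p ∈ A ∧ q ∈ A ∧ r ∈ A := by
    have : ∀ u ∈ ({x, y, z} : Set α), u ∈ A := by rintro u (rfl | rfl | rfl) <;> assumption
    rw [← e] at this
    simpa using this
  obtain ⟨hpA, hqA, hrA⟩ := hpA
  have kp := hcompl p (by simp)
  have kq := hcompl q (by simp)
  have kr := hcompl r (by simp)
  rw [← e] at h3
  refine ⟨p, q, r, e, hpq, hpr, hqr,
    ⟨hp.1, hp.2.1, kp.1.1 hp.1, hp.2.2.1, hp.2.2.2, by_contra fun hh ↦ hp.2.2.1 (kp.2.2 hh)⟩,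
    ⟨hq.1, hq.2.1, by_contra fun hh ↦ hq.1 (kq.1.2 hh), hq.2.2.1, hq.2.2.2, kq.2.1 hq.2.2.1⟩,
    fun hrb ↦ ?_, fun hrb ↦ ?_⟩
  -- Since `p` swaps with neither `c` nor `d`, the pair `{q, r}` must take `{c, d}`, so `r` swaps
  -- with one of them.
  · have h4 := h.rules.pair_of_triple hpA hqA hrA hpq hpr hqr hb hc hd hbc hbd h3.1
      hp.2.1 (kp.1.1 hp.1)
    rw [pair_comm q r] at h4
    exact (h.rules.row r hrA q hqA c hc d hd h4).elim (hr.1.1 hrb) (kr.1.1 hrb)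
  · rw [insert_comm p q] at h3
    have h4 := h.rules_symm.pair_of_triple hqA hpA hrA hpq.symm hqr hpr hb hc hd hbc hbd h3.2
      hq.2.2.2 (kq.2.1 hq.2.2.1)
    rw [pair_comm p r] at h4
    exact (h.rules_symm.row r hrA p hpA c hc d hd h4).elim (hr.2.1 hrb) (kr.2.1 hrb)

theorem exists_serial_exchange_pair [M.RankFinite] (h : M.NoTripleExchange A B) (hx : x ∈ A)
    (hy : y ∈ A) (hxy : x ≠ y) :
    ∃ a ∈ A, ∃ a' ∈ A, ∃ b ∈ B, ∃ c ∈ B, a ≠ a' ∧ b ≠ c ∧ M.IsBiSwap A B {a} {b} ∧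
      M.IsBiSwap A B {a, a'} {b, c} := by
  obtain ⟨b, hb, h1⟩ := h.right.exists_isBiSwap_singleton h.left h.disjoint.symm hx
  obtain ⟨c, hc, d, hd, hcd, h2⟩ := h.right.exists_isBiSwap_pair h.left hx hy hxy
  rw [isBiSwap_comm] at h1 h2
  by_cases h3 : M.IsBiSwap A B {x} {c}
  · exact ⟨x, hx, y, hy, c, hc, d, hd, hxy, hcd, h3, h2⟩
  have hbc : b ≠ c := by rintro rfl; contradiction
  obtain ⟨a', ha', hne, h4⟩ := h1.exists_pair h.disjoint hx hb hc hbc h3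
  exact ⟨x, hx, a', ha', b, hb, c, hc, hne, hbc, h1, h4⟩

/-- Exchange a third element `d` after a serial pair: a triple is excluded, so `d` replaces `c` or
`b`. A resulting pair with `{c, d}` that is not serial is discarded, and `d` is exchanged after `(a,
b)` instead. -/
theorem exists_covers [M.RankFinite] (h : M.NoTripleExchange A B) (hA : 3 ≤ A.encard) :
    ∃ b ∈ B, ∃ c ∈ B, ∃ d ∈ B, b ≠ c ∧ b ≠ d ∧ c ≠ d ∧ M.Covers A B b c ∧ M.Covers A B b d := by
  obtain ⟨x, y, hx, hy, hxy⟩ := one_lt_encard_iff.1 (lt_of_lt_of_le (by norm_num) hA)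
  obtain ⟨a, ha, a', ha', b, hb, c, hc, haa', hbc, h1, h2⟩ := h.exists_serial_exchange_pair hx hy hxy
  have hs : M.IsSerialPair A B a a' b c := ⟨h2, a, by simp, b, by simp, h1⟩
  have hCc := h.covers hs ha ha' haa' hb hc hbc
  obtain ⟨d, hd, hbd, hcd⟩ : ∃ d ∈ B, b ≠ d ∧ c ≠ d := by
    by_contra! hcon
    have hsub : B ⊆ {b, c} := by grind
    have := encard_le_encard hsub
    rw [encard_pair hbc, ← h.left.encard_eq_encard_of_isBase h.right] at this
    exact absurd (hA.trans this) (by norm_num)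
  obtain h3 | h3 | ⟨a'', ha'', hne, hne', h3⟩ :=
    (isBiSwap_comm.1 h2).exchange h.disjoint.symm hb hc hd hbc hbd hcd ha ha'
  · have hCd := h.covers ⟨isBiSwap_comm.1 h3, a, by simp, b, by simp, h1⟩ ha ha' haa' hb hd hbd
    exact ⟨b, hb, c, hc, d, hd, hbc, hbd, hcd, hCc, hCd⟩
  · by_cases h4 : ∃ u ∈ ({a, a'} : Set α), ∃ v ∈ ({c, d} : Set α), M.IsBiSwap A B {u} {v}
    · have hCd := h.covers ⟨isBiSwap_comm.1 h3, h4⟩ ha ha' haa' hc hd hcd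
      exact ⟨c, hc, b, hb, d, hd, hbc.symm, hcd, hbd, hCc.symm, hCd⟩
    push Not at h4
    obtain ⟨u, hu, hau, h5⟩ := h1.exists_pair h.disjoint ha hb hd hbd
      (h4 a (by simp) d (by simp))
    have hCd := h.covers ⟨h5, a, by simp, b, by simp, h1⟩ ha hu hau hb hd hbd
    exact ⟨b, hb, c, hc, d, hd, hbc, hbd, hcd, hCc, hCd⟩
  · exact (h.not_isBiSwap_of_isSerialPair hs ha ha' ha'' haa' hne hne' hb hc hd hbc hbd hcd
      (isBiSwap_comm.1 h3)).elim

/-- Covering makes `x` exchangeable with `b`, so `{a, x}` with `{b, c}` is serial. In a rigid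
triple, `triple` gives one of the two relations for adding `q` and the other for adding `p`, so the
missing ones fail. Then `exists_triple` forces both for adding `r`. -/
theorem false_of_opposite [M.RankFinite] (h : M.NoTripleExchange A B) (ha : a ∈ A) (hx : x ∈ A)
    (hax : a ≠ x) (hb : b ∈ B) (hc : c ∈ B) (hd : d ∈ B) (hbc : b ≠ c) (hbd : b ≠ d)
    (hcd : c ≠ d) (hCc : M.Covers A B b c) (hCd : M.Covers A B b d)
    (hab : M.IsBiSwap A B {a} {b}) (hax2 : M.IsBiSwap A B {a, x} {c, d})
    (hac : M.IsSwap A {a} {c}) (hac' : ¬ M.IsSwap B {c} {a})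
    (hxc : ¬ M.IsSwap A {x} {c}) (hxc' : M.IsSwap B {c} {x}) (hxd' : ¬ M.IsSwap B {d} {x}) :
    False := by
  have hxb : M.IsBiSwap A B {x} {b} :=
    ⟨(hCc.1 x hx).resolve_right hxc, (hCd.2 x hx).resolve_right hxd'⟩
  have h2 : M.IsBiSwap A B {a, x} {b, c} := by
    refine ⟨?_, h.rules_symm.pair a ha x hx hax b hb c hc hab.2 hxc' hac'⟩
    rw [pair_comm]
    exact h.rules.pair x hx a ha hax.symm b hb c hc hxb.1 hac hxc
  have hs : M.IsSerialPair A B a x b c := ⟨h2, a, by simp, b, by simp, hab⟩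
  obtain ⟨u, hu, v, hv, w, hw, huv, huw, hvw, h3⟩ :=
    h.left.exists_isBiSwap_triple h.right hb hc hd hbc hbd hcd
  obtain ⟨p, q, r, e, hpq, hpr, hqr, hp, hq, hr⟩ :=
    h.shape hu hv hw huv huw hvw hb hc hd hbc hbd hcd hCc hCd h3
  have hA : p ∈ A ∧ q ∈ A ∧ r ∈ A := by
    have : ∀ u' ∈ ({u, v, w} : Set α), u' ∈ A := by
      rintro u' (rfl | rfl | rfl) <;> assumption
    rw [← e] at this
    simpa using this
  obtain ⟨hpA, hqA, hrA⟩ := hA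
  rw [← e] at h3
  have hap : a ≠ p := by rintro rfl; exact hp.2.2.2.1 hab.2
  have hxp : x ≠ p := by rintro rfl; exact hp.2.2.2.1 hxb.2
  have haq : a ≠ q := by rintro rfl; exact hq.1 hab.1
  have hxq : x ≠ q := by rintro rfl; exact hq.1 hxb.1
  have har : a ≠ r := by rintro rfl; exact hr.1 hab.1
  have hxr : x ≠ r := by rintro rfl; exact hr.1 hxb.1
  have hnot : ∀ u ∈ A, a ≠ u → x ≠ u → ¬ M.IsBiSwap A B {a, x, u} {b, c, d} :=
    fun u hu hau hxu ↦
      h.not_isBiSwap_of_isSerialPair hs ha hx hu hax hau hxu hb hc hd hbc hbd hcd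
  have hsq : ¬ M.IsSwap A {a, x, q} {b, c, d} := fun hsq ↦ hnot q hqA haq hxq ⟨hsq,
    h.rules_symm.triple a ha x hx q hqA haq hxq c hc d hd b hb hbc.symm hbd.symm hax2.2
      hq.2.2.2.1 hq.2.2.2.2.1 hq.2.2.2.2.2⟩
  have htp : ¬ M.IsSwap B {b, c, d} {a, x, p} := fun htp ↦ hnot p hpA hap hxp
    ⟨h.rules.triple a ha x hx p hpA hap hxp c hc d hd b hb hbc.symm hbd.symm hax2.1
      hp.1 hp.2.1 hp.2.2.1, htp⟩
  have hsqr : M.IsSwap A {q, r} {c, d} :=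
    h.rules.pair_of_triple hpA hqA hrA hpq hpr hqr hb hc hd hbc hbd h3.1 hp.2.1 hp.2.2.1
  rw [insert_comm p q] at h3
  have htpr : M.IsSwap B {c, d} {p, r} :=
    h.rules_symm.pair_of_triple hqA hpA hrA hpq.symm hqr hpr hb hc hd hbc hbd h3.2
      hq.2.2.2.2.1 hq.2.2.2.2.2
  exact hnot r hrA har hxr
    ⟨(h.rules.exists_triple a ha x hx q hqA r hrA haq hxq har hxr b hb c hc d hd hbd hcd h2.1
        hsqr hq.1 hr.1).resolve_left hsq,
      (h.rules_symm.exists_triple a ha x hx p hpA r hrA hap hxp har hxr b hb c hc d hd hbd hcd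
        h2.2 htpr hp.2.2.2.1 hr.2).resolve_left htp⟩

theorem encard_lt [M.RankFinite] (h : M.NoTripleExchange A B) : A.encard < 3 := by
  by_contra! hA
  obtain ⟨b, hb, c, hc, d, hd, hbc, hbd, hcd, hCc, hCd⟩ := h.exists_covers hA
  obtain ⟨a, ha, hab⟩ := h.left.exists_isBiSwap_singleton h.right h.disjoint hb
  obtain ⟨x, hx, hax, h2⟩ | ⟨x, hx, y, hy, hax, hay, hxy, h3⟩ :=
    hab.exists_pair_or_triple h.disjoint ha hb hc hd hbc hbd hcd
  · by_cases h4 : ∃ u ∈ ({a, x} : Set α), ∃ v ∈ ({c, d} : Set α), M.IsBiSwap A B {u} {v}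
    · have hC := h.covers ⟨h2, h4⟩ ha hx hax hc hd hcd
      obtain ⟨u, hu, v, hv, w, hw, huv, huw, hvw, h3⟩ :=
        h.left.exists_isBiSwap_triple h.right hb hc hd hbc hbd hcd
      obtain ⟨p, q, r, e, -, -, -, hp, -⟩ :=
        h.shape hu hv hw huv huw hvw hb hc hd hbc hbd hcd hCc hCd h3
      have hpA : p ∈ A := by
        have : p ∈ ({u, v, w} : Set α) := e ▸ by simp
        grind
      exact (hC.1 p hpA).elim hp.2.1 hp.2.2.1
    have hno : ∀ u ∈ ({a, x} : Set α), ∀ v ∈ ({c, d} : Set α),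
        ¬ (M.IsSwap A {u} {v} ∧ M.IsSwap B {v} {u}) := fun u hu v hv huv ↦
      h4 ⟨u, hu, v, hv, huv⟩
    obtain ⟨h5, h6, h7, h8, h9, h10, h11, h12⟩ | ⟨h5, h6, h7, h8, h9, h10, h11, h12⟩ :=
      h.rules.opposite h.rules_symm ha hx hc hd h2.1 h2.2 hno
    · exact h.false_of_opposite ha hx hax hb hc hd hbc hbd hcd hCc hCd hab h2 h5 h7 h9 h11 h12
    · rw [pair_comm c d] at h2
      exact h.false_of_opposite ha hx hax hb hd hc hbd hbc hcd.symm hCd hCc hab h2 h10 h12 h6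
        h8 h7
  · obtain ⟨p, q, r, e, -, -, -, hp, hq, hr⟩ :=
      h.shape ha hx hy hax hay hxy hb hc hd hbc hbd hcd hCc hCd h3
    have hmem : a ∈ ({p, q, r} : Set α) := e ▸ by simp
    obtain rfl | rfl | rfl := hmem
    · exact hp.2.2.2.1 hab.2
    · exact hq.1 hab.1
    · exact hr.1 hab.1

end NoTripleExchange

/-! ### From set exchanges to the serial exchange -/

theorem isSerialSymmetricExchange_triple (hAB : Disjoint A B) {a₁ a₂ a₃ b₁ b₂ b₃ : α}
    (ha₁ : a₁ ∈ A) (ha₂ : a₂ ∈ A) (ha₃ : a₃ ∈ A) (hb₁ : b₁ ∈ B) (hb₂ : b₂ ∈ B) (hb₃ : b₃ ∈ B)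
    (ha₁₂ : a₁ ≠ a₂) (ha₁₃ : a₁ ≠ a₃) (ha₂₃ : a₂ ≠ a₃) (hb₁₂ : b₁ ≠ b₂) (hb₁₃ : b₁ ≠ b₃)
    (hb₂₃ : b₂ ≠ b₃) (h1 : M.IsBiSwap A B {a₁} {b₁}) (h2 : M.IsBiSwap A B {a₁, a₂} {b₁, b₂})
    (h3 : M.IsBiSwap A B {a₁, a₂, a₃} {b₁, b₂, b₃}) :
    M.IsSerialSymmetricExchange A B [(a₁, b₁), (a₂, b₂), (a₃, b₃)] := by
  have hdis : ∀ u ∈ A, ∀ v ∈ B, u ≠ v := fun u hu v hv ↦ hAB.ne_of_mem hu hv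
  have e1 : insert b₁ (A \ {a₁}) = A \ {a₁} ∪ {b₁} := by grind
  have e2 : insert a₁ (B \ {b₁}) = B \ {b₁} ∪ {a₁} := by grind
  have e3 : insert b₂ ((A \ {a₁} ∪ {b₁}) \ {a₂}) = A \ {a₁, a₂} ∪ {b₁, b₂} := by grind
  have e4 : insert a₂ ((B \ {b₁} ∪ {a₁}) \ {b₂}) = B \ {b₁, b₂} ∪ {a₁, a₂} := by grind
  have e5 : insert b₃ ((A \ {a₁, a₂} ∪ {b₁, b₂}) \ {a₃}) =
      A \ {a₁, a₂, a₃} ∪ {b₁, b₂, b₃} := by grind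
  have e6 : insert a₃ ((B \ {b₁, b₂} ∪ {a₁, a₂}) \ {b₃}) =
      B \ {b₁, b₂, b₃} ∪ {a₁, a₂, a₃} := by grind
  simp only [IsSerialSymmetricExchange, Exchangeable, e1, e2, e3, e4, e5, e6, and_true]
  exact ⟨⟨ha₁, hb₁, h1.1, h1.2⟩, ⟨.inl ⟨ha₂, ha₁₂.symm⟩, .inl ⟨hb₂, hb₁₂.symm⟩, h2.1, h2.2⟩,
    .inl ⟨ha₃, by grind⟩, .inl ⟨hb₃, by grind⟩, h3.1, h3.2⟩

end Matroid

theorem mainTheorem1 {α : Type*} (M : Matroid α) [M.Finite] (hM : 3 ≤ M.eRank)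
    (A B : Set α) (hA : M.IsBase A) (hB : M.IsBase B) (hAB : Disjoint A B) :
    ∃ a₁ ∈ A, ∃ a₂ ∈ A, ∃ a₃ ∈ A, ∃ b₁ ∈ B, ∃ b₂ ∈ B, ∃ b₃ ∈ B,
      a₁ ≠ a₂ ∧ a₁ ≠ a₃ ∧ a₂ ≠ a₃ ∧ b₁ ≠ b₂ ∧ b₁ ≠ b₃ ∧ b₂ ≠ b₃ ∧
      M.IsSerialSymmetricExchange A B [(a₁, b₁), (a₂, b₂), (a₃, b₃)] := by
  by_contra hcon
  refine absurd (Matroid.NoTripleExchange.encard_lt (M := M) (A := A) (B := B) ⟨hA, hB, hAB, ?_⟩)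
    (not_lt.2 (hM.trans_eq hA.encard_eq_eRank.symm))
  intro a₁ ha₁ a₂ ha₂ a₃ ha₃ ha₁₂ ha₁₃ ha₂₃ b₁ hb₁ b₂ hb₂ b₃ hb₃ hb₁₂ hb₁₃ hb₂₃ h1 h2 h3
  exact hcon ⟨a₁, ha₁, a₂, ha₂, a₃, ha₃, b₁, hb₁, b₂, hb₂, b₃, hb₃, ha₁₂, ha₁₃, ha₂₃, hb₁₂,
    hb₁₃, hb₂₃, Matroid.isSerialSymmetricExchange_triple hAB ha₁ ha₂ ha₃ hb₁ hb₂ hb₃ ha₁₂ ha₁₃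
      ha₂₃ hb₁₂ hb₁₃ hb₂₃ h1 h2 h3⟩
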